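/- Let $R$ be a commutative ring and $n\ge 0$. For a poset $C$, an $RC$-module is a functor $M$ from $C$ (viewed as a category) to the category of $R$-modules; it is *pointwise finitely presented* if $M(c)$ is a finitely presented $R$-module for every $c\in C$, and *finitely presented* if there is an exact sequence of $RC$-modules $$\bigoplus_{j\in J} R[\mathrm{Mor}_C(d_j,-)]\to\bigoplus_{i\in I} R[\mathrm{Mor}_C(c_i,-)]\to M\to 0$$ with $I,J$ finite sets and $c_i,d_j\in C$, where $R[X]$ denotes the free $R$-module on a set $X$. For $S\subseteq C$, $M$ is *$S$-determined* if every $c\in C$ with $M(c)\neq 0$ satisfies $s\le c$ for some $s\in S$, and if for all $c\le d$ in $C$ the equality $\{s\in S: s\le c\}=\{s\in S: s\le d\}$ implies that $M(c\le d)$ is an isomorphism. A morphism of posets $f\colon C\to D$ is an *encoding* of $M$ if $M\cong N\circ f$ for some $RD$-module $N$. An $R\mathbb Z^n$-module $M$ is *finitely determined* if it is pointwise finitely presented and there are $a\le b$ in $\mathbb Z^n$ such that the convex projection $\pi\colon\mathbb Z^n\to[a,b]$, $\pi(c)_i=\max(a_i,\min(c_i,b_i))$, is an encoding of $M$. Let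 $\overline{\mathbb Z}=\mathbb Z\cup\{-\infty\}$, give $\overline{\mathbb Z}^n$ the coordinatewise order, and let $\overline M$ be the coinduction (right Kan extension) of $M$ along the inclusion $\mathbb Z^n\to\overline{\mathbb Z}^n$, that is, $\overline M(c)=\lim_{d\ge c,\ d\in\mathbb Z^n}M(d)$ for $c\in\overline{\mathbb Z}^n$. **Theorem.** Let $M$ be a pointwise finitely presented $R\mathbb Z^n$-module. Then the following are equivalent: 1. $M$ is finitely determined; 2. $\overline M$ is $S$-determined for some finite $S\subseteq\overline{\mathbb Z}^n$; 3. $\overline M$ is finitely presented (as an $R\overline{\mathbb Z}^n$-module). -/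

import Mathlib

open CategoryTheory CategoryTheory.Limits

universe u

noncomputable section

/-- An `RC`-module over a poset `C`: a functor from `C` to `R`-modules. -/
abbrev PosetModule (R : Type u) [CommRing R] (C : Type) [PartialOrder C] :=
  C ⥤ ModuleCat.{u} R

namespace PosetModule

variable {R : Type u} [CommRing R] {C D : Type} [PartialOrder C] [PartialOrder D]

/-- `M` is pointwise finitely presented: every value is a finitely presented `R`-module. -/
def PointwiseFinitelyPresented (M : PosetModule R C) : Prop :=
  ∀ c : C, Module.FinitePresentation R (M.obj c)

/-- The support of `M`: the points at which the value of `M` is nonzero. -/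
def support (M : PosetModule R C) : Set C :=
  {c | Nontrivial (M.obj c)}

/-- `M` is `S`-determined: its support lies in the upset generated by `S`, and `M(c ≤ d)` is an
isomorphism whenever the same elements of `S` lie below `c` and below `d`. -/
def IsDetermined (M : PosetModule R C) (S : Set C) : Prop :=
  M.support ⊆ {c | ∃ s ∈ S, s ≤ c} ∧
    ∀ (c d : C) (h : c ≤ d), S ∩ Set.Iic c = S ∩ Set.Iic d → IsIso (M.map (homOfLE h))

/-- The poset morphism `f : C → D` is an encoding of `M`: for some `RD`-module `N`, the restriction
of `N` along `f` is isomorphic to `M`. -/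
def IsEncodedBy (M : PosetModule R C) (f : C →o D) : Prop :=
  ∃ N : PosetModule R D, Nonempty (f.monotone.functor ⋙ N ≅ M)

/-- The coinduction of `M` along `f : C → D`: the right Kan extension of `M` along `f`. -/
def coind (M : PosetModule R C) (f : C →o D) : PosetModule R D :=
  f.monotone.functor.rightKanExtension M

/-- Coinduction is computed pointwise: its value at `d` is the limit of the `M c` over the `c` with
`d ≤ f c`. -/
theorem nonempty_coind_obj_iso_limit (M : PosetModule R C) (f : C →o D) (d : D) :
    Nonempty ((M.coind f).obj d ≅ limit (StructuredArrow.proj d f.monotone.functor ⋙ M)) :=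
  ⟨f.monotone.functor.ranObjObjIsoLimit M d⟩

variable (R) in
/-- The free module `R[Mor(c, -)]` generated at the point `c`. -/
def freeAt (c : C) : PosetModule R C :=
  coyoneda.obj (Opposite.op c) ⋙ uliftFunctor.{u} ⋙ ModuleCat.free R

/-- `M` is finitely presented: there is an exact sequence
`⨁ j, R[Mor(d j, -)] → ⨁ i, R[Mor(c i, -)] → M → 0` with finite index sets. -/
def IsFinitelyPresented (M : PosetModule R C) : Prop :=
  ∃ (I J : Type) (_ : Finite I) (_ : Finite J) (c : I → C) (d : J → C)
    (f : (∐ fun j => freeAt R (d j)) ⟶ (∐ fun i => freeAt R (c i)))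
    (g : (∐ fun i => freeAt R (c i)) ⟶ M) (w : f ≫ g = 0),
    (ShortComplex.mk f g w).Exact ∧ Epi g

end PosetModule

/-- The convex projection of `ℤⁿ` onto the closed interval `[a, b]`. -/
def convexProjection {n : ℕ} {a b : Fin n → ℤ} (hab : a ≤ b) : (Fin n → ℤ) →o Set.Icc a b where
  toFun c := ⟨fun i => max (a i) (min (c i) (b i)),
    fun _ => le_max_left _ _, fun i => max_le (hab i) (min_le_right _ _)⟩
  monotone' _ _ h := fun i => max_le_max le_rfl (min_le_min (h i) le_rfl)

/-- The inclusion of `ℤⁿ` into `(ℤ ∪ {-∞})ⁿ`. -/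
def inclusionBar (n : ℕ) : (Fin n → ℤ) →o (Fin n → WithBot ℤ) where
  toFun c := fun i => (c i : WithBot ℤ)
  monotone' _ _ h := fun i => WithBot.coe_le_coe.mpr (h i)

namespace PosetModule

variable {R : Type u} [CommRing R] {n : ℕ}

/-- `M` is finitely determined: it is pointwise finitely presented, and the convex projection onto
some closed interval `[a, b]` is an encoding of `M`. -/
def IsFinitelyDetermined (M : PosetModule R (Fin n → ℤ)) : Prop :=
  M.PointwiseFinitelyPresented ∧
    ∃ (a b : Fin n → ℤ) (hab : a ≤ b), M.IsEncodedBy (convexProjection hab)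

/-- The extension of `M` to `(ℤ ∪ {-∞})ⁿ`: its coinduction along the inclusion of `ℤⁿ`. -/
def extend (M : PosetModule R (Fin n → ℤ)) : PosetModule R (Fin n → WithBot ℤ) :=
  M.coind (inclusionBar n)

end PosetModule

end

/-!
All three conditions say that `M` changes only across finitely many coordinate hyperplanes. A finite
determining set of the extension, the second condition, is the common form to which the other two
are compared; the arguments are mostly about modules over arbitrary posets and use little of
`ℤⁿ ⊆ (ℤ ∪ {-∞})ⁿ`.

*From a finite encoding to a finite determining set.* Truncating coordinates from below at `a` is a
monotone map `r` from `(ℤ ∪ {-∞})ⁿ` to `ℤⁿ` with `d ≤ r d`. If a module `F` on the large poset is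
invertible along every `d ≤ r d`, then it is coinduced from its restriction to `ℤⁿ`, because the
limit defining the coinduction at `d` is already computed by its term at `r d`
(`PosetModule.nonempty_iso_coind`). Hence a module encoded by the projection `π` to `[a, b]` extends
to the restriction of the encoding module along `π ∘ r`, and the fibres of `π ∘ r` are cut out by
the finite grid of points whose coordinates are `-∞` or lie in `(a i, b i]`
(`exists_finite_separating`).

*From a finite determining set to a finite encoding.* If all finite coordinates of `S` lie in
`(a i, b i]`, then the same elements of `S` lie below `c`, `π c` and `r c`, so both
`M c → M (r c)` and `M (π c) → M (r c)` are invertible (`PosetModule.isEncodedBy_of_isIso`).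

*From a finite determining set to a finite presentation.* Enlarge `S` to a finite grid `G` such that
below each point there is a greatest element of `G`. A module is finitely generated as soon as its
values on `G` are, and every value is hit by the value at some element of `G` below
(`PosetModule.exists_epi_of_finite`). This applies to the extension of `M` and then to the kernel
of the resulting epimorphism from a finite free module: its values on `G` are finitely generated
because the values of the extension are finitely presented.

*From a finite presentation to a finite determining set.* Take the positions of the generators and
of the relations. A transition map that is invertible on both free modules is invertible on their
cokernel, as evaluation preserves colimits (`PosetModule.isIso_map_of_exact`).
-/

noncomputable section

/-! ### Transition maps of poset modules -/

namespace PosetModule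

variable {R : Type u} [CommRing R] {C D : Type} [PartialOrder C] [PartialOrder D]

lemma IsDetermined.of_iso {M N : PosetModule R C} (e : M ≅ N) {S : Set C}
    (h : M.IsDetermined S) : N.IsDetermined S := by
  refine ⟨fun c hc => h.1 ?_, fun c d hcd hS => ?_⟩
  · have : Nontrivial (N.obj c) := hc
    exact (e.app c).toLinearEquiv.toEquiv.nontrivial
  · have := h.2 c d hcd hS
    exact (NatIso.isIso_map_iff e (homOfLE hcd)).1 this

/-- If `f ≤ g` pointwise and `F` is invertible along every `f c ≤ g c`, then the restrictions of `F`
along `f` and `g` are isomorphic. -/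
def restrictIso (F : PosetModule R D) (f g : C →o D) (h : ∀ c, f c ≤ g c)
    (hF : ∀ c, IsIso (F.map (homOfLE (h c)))) :
    f.monotone.functor ⋙ F ≅ g.monotone.functor ⋙ F :=
  NatIso.ofComponents (fun c => @asIso _ _ _ _ (F.map (homOfLE (h c))) (hF c)) (by
    intro c d k
    exact (F.map_comp (f.monotone.functor.map k) (homOfLE (h d))).symm.trans
      (F.map_comp (homOfLE (h c)) (g.monotone.functor.map k)))

lemma isIso_map_coproduct {I : Type} (F : I → PosetModule R C) {c d : C} (k : c ⟶ d)
    (h : ∀ i, IsIso ((F i).map k)) : IsIso ((∐ F).map k) := by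
  have : IsIso (Functor.whiskerLeft (Discrete.functor F)
      ((evaluation C (ModuleCat.{u} R)).map k)) := by
    rw [NatTrans.isIso_iff_isIso_app]
    rintro ⟨i⟩
    exact h i
  exact isIso_app_coconePt_of_preservesColimit (Discrete.functor F)
    ((evaluation C (ModuleCat.{u} R)).map k) _ (colimit.isColimit _)

lemma isIso_map_of_exact {X : ShortComplex (PosetModule R C)} (hX : X.Exact) [Epi X.g] {c d : C}
    (k : c ⟶ d) (h₁ : IsIso (X.X₁.map k)) (h₂ : IsIso (X.X₂.map k)) : IsIso (X.X₃.map k) := by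
  have : IsIso (Functor.whiskerLeft (parallelPair X.f 0)
      ((evaluation C (ModuleCat.{u} R)).map k)) := by
    rw [NatTrans.isIso_iff_isIso_app]
    rintro (_ | _)
    · exact h₁
    · exact h₂
  exact isIso_app_coconePt_of_preservesColimit (parallelPair X.f 0)
    ((evaluation C (ModuleCat.{u} R)).map k) _ hX.gIsCokernel

/-! ### Determining sets of finitely presented modules -/

lemma isIso_freeAt_map {x c d : C} (k : c ⟶ d) (h : x ≤ d → x ≤ c) :
    IsIso ((freeAt R x).map k) := by
  have : IsIso ((coyoneda.obj (Opposite.op x)).map k) := by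
    rw [isIso_iff_bijective]
    exact ⟨fun _ _ _ => Subsingleton.elim (α := x ⟶ c) _ _,
      fun y => ⟨homOfLE (h (leOfHom y)), Subsingleton.elim (α := x ⟶ d) _ _⟩⟩
  exact inferInstanceAs (IsIso ((uliftFunctor.{u} ⋙ ModuleCat.free R).map
    ((coyoneda.obj (Opposite.op x)).map k)))

lemma subsingleton_freeAt_obj {x c : C} (h : ¬ x ≤ c) : Subsingleton ((freeAt R x).obj c) := by
  have : IsEmpty (ULift.{u} (x ⟶ c)) := ⟨fun k => h (leOfHom k.down)⟩
  exact inferInstanceAs (Subsingleton (ULift.{u} (x ⟶ c) →₀ R))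

lemma finite_freeAt_obj (x c : C) : Module.Finite R ((freeAt R x).obj c) :=
  have : Finite (ULift.{u} (x ⟶ c)) := Finite.of_subsingleton
  inferInstanceAs (Module.Finite R (ULift.{u} (x ⟶ c) →₀ R))

open DirectSum in
/-- Coproducts of poset modules are direct sums pointwise. -/
def coproductObjEquiv {I : Type} [DecidableEq I] (F : I → PosetModule R C) (c : C) :
    (∐ F).obj c ≃ₗ[R] ⨁ i, (F i).obj c :=
  (PreservesCoproduct.iso ((evaluation C (ModuleCat.{u} R)).obj c) F ≪≫
    ModuleCat.coprodIsoDirectSum.{u} fun i => (F i).obj c).toLinearEquiv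

lemma finite_coproduct_freeAt_obj {I : Type} [Finite I] (x : I → C) (c : C) :
    Module.Finite R ((∐ fun i => freeAt R (x i)).obj c) := by
  classical
  have := fun i => finite_freeAt_obj (R := R) (x i) c
  have := Fintype.ofFinite I
  exact Module.Finite.equiv (coproductObjEquiv (fun i => freeAt R (x i)) c).symm

/-- Over any poset, a finitely presented module is determined by the finite set of positions of its
generators and relations. -/
lemma IsFinitelyPresented.exists_isDetermined {M : PosetModule R C} (hM : M.IsFinitelyPresented) :
    ∃ S : Set C, S.Finite ∧ M.IsDetermined S := by
  classical
  obtain ⟨I, J, _, _, x, y, f, g, w, hex, hg⟩ := hM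
  refine ⟨Set.range x ∪ Set.range y, (Set.finite_range x).union (Set.finite_range y), ?_, ?_⟩
  · intro c hc
    by_contra hcon
    simp only [Set.mem_ofPred_eq, not_exists, not_and] at hcon
    have h0 : ∀ i, Subsingleton ((freeAt R (x i)).obj c) := fun i =>
      subsingleton_freeAt_obj (hcon _ (Or.inl ⟨i, rfl⟩))
    have h1 : Subsingleton ((∐ fun i => freeAt R (x i)).obj c) :=
      (coproductObjEquiv (fun i => freeAt R (x i)) c).toEquiv.subsingleton_congr.2 inferInstance
    have h2 : Function.Surjective (g.app c) :=
      (ModuleCat.epi_iff_surjective _).1 inferInstance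
    have : Nontrivial (M.obj c) := hc
    exact not_subsingleton (M.obj c) h2.subsingleton
  · intro c d h hS
    have key : ∀ s ∈ Set.range x ∪ Set.range y, s ≤ d → s ≤ c := fun s hs hsd =>
      (hS.symm.subset ⟨hs, hsd⟩ : s ∈ _ ∩ Set.Iic c).2
    refine isIso_map_of_exact hex (homOfLE h) ?_ ?_
    · exact isIso_map_coproduct _ _ fun j => isIso_freeAt_map _ (key _ (Or.inr ⟨j, rfl⟩))
    · exact isIso_map_coproduct _ _ fun i => isIso_freeAt_map _ (key _ (Or.inl ⟨i, rfl⟩))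

/-! ### Finite presentation from a finite grid -/

/-- The morphism `R[Mor(x, -)] ⟶ F` that corresponds to an element of `F x` under the Yoneda
lemma. -/
def freeAtDesc (F : PosetModule R C) {x : C} (m : F.obj x) : freeAt R x ⟶ F where
  app c := ModuleCat.freeDesc (↾fun k => F.map k.down m)
  naturality c d k := by
    apply ModuleCat.free_hom_ext
    intro l
    change ModuleCat.freeDesc _ ((ModuleCat.free R).map _ (ModuleCat.freeMk l)) =
      F.map k (ModuleCat.freeDesc _ (ModuleCat.freeMk l))
    rw [ModuleCat.free_map_apply, ModuleCat.freeDesc_apply, ModuleCat.freeDesc_apply]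
    exact congrArg (fun t : F.obj x ⟶ F.obj d => t m) (F.map_comp l.down k)

lemma mem_range_freeAtDesc (F : PosetModule R C) {x : C} (m : F.obj x) :
    m ∈ LinearMap.range ((F.freeAtDesc m).app x).hom := by
  refine ⟨ModuleCat.freeMk (ULift.up (𝟙 x)), ?_⟩
  refine (ModuleCat.freeDesc_apply _ _).trans ?_
  simp

/-- Generators of the finitely many modules `F x`, `x ∈ G`, generate `F` if every value of `F` is
the image of the value at some point of `G`. -/
lemma exists_epi_of_finite (F : PosetModule R C) {G : Set C} (hG : G.Finite)
    (hfin : ∀ x ∈ G, Module.Finite R (F.obj x))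
    (hsurj : ∀ c, ∃ x ∈ G, ∃ h : x ≤ c, Function.Surjective (F.map (homOfLE h))) :
    ∃ (I : Type) (_ : Finite I) (x : I → C) (p : (∐ fun i => freeAt R (x i)) ⟶ F),
      (∀ i, x i ∈ G) ∧ Epi p := by
  have : Finite G := hG
  have := fun x : G => hfin x x.2
  choose k s hs using fun x : G => Module.Finite.exists_fin (R := R) (M := F.obj x.1)
  let I := Σ x : G, Fin (k x)
  let p : (∐ fun i : I => freeAt R i.1.1) ⟶ F := Sigma.desc fun i => F.freeAtDesc (s i.1 i.2)
  refine ⟨I, inferInstance, fun i => i.1.1, p, fun i => i.1.2, ?_⟩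
  -- On `G` all generators are hit; elsewhere surjectivity follows by naturality.
  have hp : ∀ x : G, LinearMap.range (p.app x.1).hom = ⊤ := by
    intro x
    rw [← top_le_iff, ← hs x, Submodule.span_le]
    rintro _ ⟨j, rfl⟩
    obtain ⟨z, hz⟩ := F.mem_range_freeAtDesc (s x j)
    refine ⟨(Sigma.ι (fun i : I => freeAt R i.1.1) ⟨x, j⟩).app x.1 z, ?_⟩
    have h1 : Sigma.ι (fun i : I => freeAt R i.1.1) ⟨x, j⟩ ≫ p = F.freeAtDesc (s x j) :=
      Sigma.ι_desc _ _
    rw [← hz, ← h1]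
    rfl
  rw [NatTrans.epi_iff_epi_app]
  intro c
  rw [ModuleCat.epi_iff_surjective]
  intro y
  obtain ⟨x, hx, h, hsur⟩ := hsurj c
  obtain ⟨z, rfl⟩ := hsur y
  obtain ⟨t, rfl⟩ := LinearMap.range_eq_top.1 (hp ⟨x, hx⟩) z
  exact ⟨(∐ fun i : I => freeAt R i.1.1).map (homOfLE h) t,
    NatTrans.naturality_apply p (homOfLE h) t⟩

/-- A pointwise finitely presented module determined by a subset of a finite set `G` is finitely
presented if `G` has a greatest element `r c` below each point `c`. The module and a finite free
cover of it with generators in `G` are both invertible along `r c ≤ c`, so the kernel of the cover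
is generated by its values on `G`. -/
lemma IsDetermined.isFinitelyPresented {M : PosetModule R C} {S G : Set C}
    (hS : M.IsDetermined S) (hM : M.PointwiseFinitelyPresented) (hG : G.Finite) (hSG : S ⊆ G)
    (hmax : ∀ c, ∃ x, IsGreatest (G ∩ Set.Iic c) x) : M.IsFinitelyPresented := by
  choose r hr using hmax
  have hrle : ∀ c, r c ≤ c := fun c => (hr c).1.2
  have hle : ∀ c, ∀ s ∈ G, s ≤ c → s ≤ r c := fun c s hs hsc => (hr c).2 ⟨hs, hsc⟩
  have hMiso : ∀ c, IsIso (M.map (homOfLE (hrle c))) := fun c =>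
    hS.2 _ _ (hrle c) (Set.ext fun s => and_congr_right fun hs =>
      ⟨fun h => le_trans h (hrle c), hle c s (hSG hs)⟩)
  obtain ⟨I, _, x, p, hx, hp⟩ := M.exists_epi_of_finite hG
    (fun c _ => have := hM c; inferInstance) (fun c => ⟨r c, (hr c).1.1, hrle c,
      ((ConcreteCategory.isIso_iff_bijective _).1 (hMiso c)).2⟩)
  have hker : ∀ c (z : (∐ fun i => freeAt R (x i)).obj c), p.app c z = 0 →
      ∃ w : (kernel p).obj c, (kernel.ι p).app c w = z := by
    intro c
    have h1 : (ShortComplex.mk (kernel.ι p) p (kernel.condition p)).Exact :=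
      ShortComplex.exact_kernel p
    have h2 := h1.map ((evaluation C (ModuleCat.{u} R)).obj c)
    exact (ShortComplex.moduleCat_exact_iff _).1 h2
  have hinj : ∀ c, Function.Injective ((kernel.ι p).app c) := fun c =>
    (ModuleCat.mono_iff_injective _).1 inferInstance
  obtain ⟨J, _, y, q, -, hq⟩ := (kernel p).exists_epi_of_finite hG (fun c _ => by
      have := hM c
      have := finite_coproduct_freeAt_obj (R := R) x c
      have hfg := Module.FinitePresentation.fg_ker (p.app c).hom
        ((ModuleCat.epi_iff_surjective _).1 inferInstance)
      have hrange : LinearMap.range ((kernel.ι p).app c).hom = LinearMap.ker (p.app c).hom := by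
        refine le_antisymm ?_ fun z hz => hker c z hz
        rintro _ ⟨w, rfl⟩
        have h3 : ((kernel.ι p) ≫ p).app c w = 0 := by rw [kernel.condition]; rfl
        exact h3
      rw [← hrange] at hfg
      have := Module.Finite.of_fg hfg
      exact Module.Finite.equiv (LinearEquiv.ofInjective ((kernel.ι p).app c).hom (hinj c)).symm)
    (fun c => ⟨r c, (hr c).1.1, hrle c, by
      intro w
      have hiso : IsIso ((∐ fun i => freeAt R (x i)).map (homOfLE (hrle c))) :=
        isIso_map_coproduct _ _ fun i => isIso_freeAt_map _ (hle c _ (hx i))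
      obtain ⟨z, hz⟩ := ((ConcreteCategory.isIso_iff_bijective _).1 hiso).2 ((kernel.ι p).app c w)
      have h0 : p.app (r c) z = 0 := by
        -- `M` is injective along `r c ≤ c`, so the preimage `z` lies in the kernel at `r c`.
        apply ((ConcreteCategory.isIso_iff_bijective _).1 (hMiso c)).1
        rw [map_zero, ← NatTrans.naturality_apply, hz]
        have h3 : ((kernel.ι p) ≫ p).app c w = 0 := by rw [kernel.condition]; rfl
        exact h3
      obtain ⟨v, rfl⟩ := hker _ z h0
      refine ⟨v, hinj c ?_⟩
      rw [← hz, NatTrans.naturality_apply]⟩)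
  refine ⟨I, J, inferInstance, inferInstance, x, y, q ≫ kernel.ι p, p, by simp, ?_, hp⟩
  exact (ShortComplex.exact_iff_of_epi_of_isIso_of_mono
    (S₁ := ShortComplex.mk (q ≫ kernel.ι p) p (by simp))
    (S₂ := ShortComplex.mk (kernel.ι p) p (kernel.condition p))
    { τ₁ := q, τ₂ := 𝟙 _, τ₃ := 𝟙 _ }).2 (ShortComplex.exact_kernel p)

end PosetModule

/-! ### Grids and truncation in `(ℤ ∪ {-∞})ⁿ` -/

/-- Every finite set lies in a finite grid, namely the product of its coordinate projections with
`⊥` adjoined, and a grid containing `⊥` has a greatest element below each point. -/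
lemma exists_finite_superset_isGreatest {n : ℕ} {S : Set (Fin n → WithBot ℤ)} (hS : S.Finite) :
    ∃ G : Set (Fin n → WithBot ℤ), G.Finite ∧ S ⊆ G ∧
      ∀ c, ∃ x, IsGreatest (G ∩ Set.Iic c) x := by
  let T : Fin n → Set (WithBot ℤ) := fun i => insert ⊥ ((fun s => s i) '' S)
  have hT : ∀ i, (T i).Finite := fun i => (hS.image _).insert _
  refine ⟨Set.pi Set.univ T, Set.Finite.pi hT, ?_, fun c => ?_⟩
  · exact fun s hs i _ => Or.inr ⟨s, hs, rfl⟩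
  · have h : ∀ i, ∃ t, IsGreatest (T i ∩ Set.Iic (c i)) t := fun i => by
      obtain ⟨t, ht, hmax⟩ := Set.exists_max_image (T i ∩ Set.Iic (c i)) id
        ((hT i).inter_of_left _) ⟨⊥, Or.inl rfl, Set.mem_Iic.2 bot_le⟩
      exact ⟨t, ht, hmax⟩
    choose t ht using h
    exact ⟨t, ⟨fun i _ => (ht i).1.1, fun i => (ht i).1.2⟩,
      fun s hs i => (ht i).2 ⟨hs.1 i trivial, hs.2 i⟩⟩

lemma exists_bounds {n : ℕ} {S : Set (Fin n → WithBot ℤ)} (hS : S.Finite) :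
    ∃ a b : Fin n → ℤ, a ≤ b ∧ ∀ s ∈ S, ∀ i, ∀ z : ℤ, s i = z → a i < z ∧ z ≤ b i := by
  have hfin : ∀ i, {z : ℤ | ∃ s ∈ S, s i = z}.Finite := fun i =>
    (hS.image fun s => s i : ((fun s => s i) '' S).Finite).preimage
      (f := ((↑) : ℤ → WithBot ℤ)) WithBot.coe_injective.injOn
  choose l hl using fun i => (hfin i).bddBelow
  choose u hu using fun i => (hfin i).bddAbove
  -- The upper bound is raised to at least `l i`, as there may be no finite coordinate at all.
  refine ⟨fun i => l i - 1, fun i => max (u i) (l i), fun i => ?_, fun s hs i z hz => ⟨?_, ?_⟩⟩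
  · have := le_max_right (u i) (l i)
    show l i - 1 ≤ max (u i) (l i)
    omega
  · have : l i ≤ z := hl i ⟨s, hs, hz⟩
    show l i - 1 < z
    omega
  · have : z ≤ u i := hu i ⟨s, hs, hz⟩
    exact this.trans (le_max_left _ _)

/-- Truncation from below at `a`, with `-∞` sent to `a i`: the join with `a`, read in `ℤⁿ`. -/
def truncateBelow {n : ℕ} (a : Fin n → ℤ) : (Fin n → WithBot ℤ) →o (Fin n → ℤ) where
  toFun c i := max (a i) ((c i).unbotD (a i))
  monotone' c d h i := by
    have hi := h i
    cases hc : c i with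
    | bot =>
      simp [hc]
    | coe y =>
      cases hd : d i with
      | bot => simp [hc, hd] at hi
      | coe z =>
        rw [hc, hd, WithBot.coe_le_coe] at hi
        simpa [hc, hd] using max_le_max (le_refl (a i)) hi

lemma le_truncateBelow {n : ℕ} (a : Fin n → ℤ) (c : Fin n → WithBot ℤ) :
    c ≤ inclusionBar n (truncateBelow a c) := fun i => by
  show c i ≤ ((max (a i) ((c i).unbotD (a i)) : ℤ) : WithBot ℤ)
  cases h : c i with
  | bot => exact bot_le
  | coe z => simp

lemma inter_Iic_truncateBelow {n : ℕ} {S : Set (Fin n → WithBot ℤ)} {a : Fin n → ℤ}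
    (ha : ∀ s ∈ S, ∀ i, ∀ z : ℤ, s i = z → a i < z) (c : Fin n → WithBot ℤ) :
    S ∩ Set.Iic c = S ∩ Set.Iic (inclusionBar n (truncateBelow a c)) := by
  refine Set.ext fun s => and_congr_right fun hs =>
    ⟨fun h => le_trans h (le_truncateBelow a c), fun h i => ?_⟩
  have hi : s i ≤ ((max (a i) ((c i).unbotD (a i)) : ℤ) : WithBot ℤ) := h i
  cases hz : s i with
  | bot => exact bot_le
  | coe z =>
    have h1 := ha s hs i z hz
    rw [hz, WithBot.coe_le_coe] at hi
    cases hc : c i with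
    | bot => simp [hc] at hi; omega
    | coe y =>
      rw [hc, WithBot.unbotD_coe] at hi
      rw [WithBot.coe_le_coe]
      omega

/-! ### Coinduction along an embedding of posets -/

namespace PosetModule

variable {R : Type u} [CommRing R] {C D E : Type} [PartialOrder C] [PartialOrder D] [PartialOrder E]

lemma nonempty_restrict_coind_iso (M : PosetModule R C) (f : C →o D)
    (hf : ∀ x y, f x ≤ f y → x ≤ y) : Nonempty (f.monotone.functor ⋙ M.coind f ≅ M) := by
  have : f.monotone.functor.Full :=
    ⟨fun {c d} k => ⟨homOfLE (hf _ _ (leOfHom k)), Subsingleton.elim _ _⟩⟩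
  have : f.monotone.functor.Faithful := ⟨fun _ => Subsingleton.elim _ _⟩
  have : IsIso (f.monotone.functor.ranCounit.app M) :=
    (f.monotone.functor.isPointwiseRightKanExtensionRanCounit M).isIso_hom
  exact ⟨@asIso _ _ _ _ (f.monotone.functor.ranCounit.app M) this⟩

lemma isIso_map_of_eq (F : PosetModule R C) {c d : C} (h : c ≤ d) (e : c = d) :
    IsIso (F.map (homOfLE h)) := by
  subst e
  have : homOfLE h = 𝟙 c := Subsingleton.elim _ _
  rw [this]
  infer_instance

/-- If the embedding `f` admits a monotone `r` in the other direction with `d ≤ f (r d)`, and `F` is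
invertible along these inequalities, then `F` is coinduced from its restriction along `f`: a cone
over the `F (f c)` with `d ≤ f c` is determined by its component at `c = r d`. -/
lemma nonempty_iso_coind (F : PosetModule R D) (f : C →o D) (hf : ∀ x y, f x ≤ f y → x ≤ y)
    (r : D →o C) (hr : ∀ d, d ≤ f (r d)) (hF : ∀ d, IsIso (F.map (homOfLE (hr d)))) :
    Nonempty (F ≅ PosetModule.coind (f.monotone.functor ⋙ F) f) := by
  let X (d : D) (c : C) (h : d ≤ f c) : StructuredArrow d f.monotone.functor :=
    StructuredArrow.mk (Y := c) (homOfLE h)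
  have hlim : (Functor.RightExtension.mk F
      (𝟙 (f.monotone.functor ⋙ F))).IsPointwiseRightKanExtension := fun d => by
    have := hF d
    let t (s : Cone (StructuredArrow.proj d f.monotone.functor ⋙ f.monotone.functor ⋙ F)) (c : C)
      (h : d ≤ f c) : s.pt ⟶ F.obj (f c) := s.π.app (X d c h)
    have ht : ∀ s (c c' : C) (h : d ≤ f c) (hc : c ≤ c'),
        t s c h ≫ F.map (homOfLE (f.monotone hc)) = t s c' (h.trans (f.monotone hc)) :=
      fun s c c' h hc => s.w (StructuredArrow.homMk (f := X d c h)
        (f' := X d c' (h.trans (f.monotone hc))) (homOfLE hc) (Subsingleton.elim _ _))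
    have hfac : ∀ s (c : C) (h : d ≤ f c),
        (t s (r d) (hr d) ≫ inv (F.map (homOfLE (hr d)))) ≫ F.map (homOfLE h) = t s c h := by
      intro s c h
      have hle : c ≤ r (f c) := hf _ _ (hr _)
      have := hF (f c)
      have h3 : F.map (homOfLE h) ≫ F.map (homOfLE (f.monotone hle)) =
          F.map (homOfLE (hr d)) ≫ F.map (homOfLE (f.monotone (r.monotone h))) := by
        rw [← F.map_comp, ← F.map_comp]
        rfl
      rw [← cancel_mono (F.map (homOfLE (hr (f c)))), Category.assoc]
      refine (congrArg (_ ≫ ·) h3).trans ?_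
      rw [Category.assoc, IsIso.inv_hom_id_assoc]
      exact (ht s _ _ _ (r.monotone h)).trans (ht s c _ h hle).symm
    have huniq : ∀ (T : ModuleCat.{u} R) (m : T ⟶ F.obj d) (m' : T ⟶ F.obj (f (r d))),
        m ≫ F.map (homOfLE (hr d)) = m' → m = m' ≫ inv (F.map (homOfLE (hr d))) :=
      fun T m m' h => (IsIso.eq_comp_inv _).2 h
    let l (s : Cone (StructuredArrow.proj d f.monotone.functor ⋙ f.monotone.functor ⋙ F)) :
      s.pt ⟶ F.obj d := t s (r d) (hr d) ≫ inv (F.map (homOfLE (hr d)))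
    exact
    { lift := l
      fac := fun s j => (congrArg (_ ≫ ·) (Category.comp_id _)).trans
        (hfac s j.right (leOfHom j.hom))
      uniq := fun s m hm =>
        huniq _ m _
          ((congrArg (m ≫ ·) (Category.comp_id _)).symm.trans (hm (X d (r d) (hr d)))) }
  have : F.IsRightKanExtension (𝟙 (f.monotone.functor ⋙ F)) :=
    Functor.RightExtension.IsPointwiseRightKanExtension.isRightKanExtension hlim
  exact ⟨Functor.rightKanExtensionUnique F (𝟙 (f.monotone.functor ⋙ F))
    (f.monotone.functor.rightKanExtension (f.monotone.functor ⋙ F))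
    (f.monotone.functor.rightKanExtensionCounit (f.monotone.functor ⋙ F))⟩

lemma isDetermined_restrict (N : PosetModule R E) (q : D →o E) {S : Set D}
    (hS : ∀ c, ∃ s ∈ S, s ≤ c)
    (hq : ∀ c d, c ≤ d → S ∩ Set.Iic c = S ∩ Set.Iic d → q c = q d) :
    IsDetermined (q.monotone.functor ⋙ N) S :=
  ⟨fun c _ => hS c, fun c d h hcd => N.isIso_map_of_eq (q.monotone h) (hq c d h hcd)⟩

/-- If `q` extends an encoding of `M` by `N` along the embedding `f` and does not distinguish `d`
from `f (r d)`, then the coinduction of `M` along `f` is encoded by `q` and the same `N`. -/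
lemma nonempty_coind_iso_restrict (M : PosetModule R C) (N : PosetModule R E) (f : C →o D)
    (hf : ∀ x y, f x ≤ f y → x ≤ y) (r : D →o C) (hr : ∀ d, d ≤ f (r d)) (q : D →o E)
    (hq : ∀ d, q d = q (f (r d))) (e : (q.comp f).monotone.functor ⋙ N ≅ M) :
    Nonempty (q.monotone.functor ⋙ N ≅ M.coind f) := by
  obtain ⟨e'⟩ := nonempty_iso_coind (q.monotone.functor ⋙ N) f hf r hr fun d =>
    N.isIso_map_of_eq (q.monotone (hr d)) (hq d)
  exact ⟨e' ≪≫ (f.monotone.functor.ran).mapIso e⟩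

/-- The module encoding `M` is the restriction of `M` along `j`; the comparison of `M (j (f c))`
with `M c` passes through a common upper bound, since `j (f c)` and `c` need not be comparable. -/
lemma isEncodedBy_of_isIso (M : PosetModule R C) (f : C →o E) (j : E →o C) (r : C →o C)
    (h₁ : ∀ c, c ≤ r c) (h₂ : ∀ c, j (f c) ≤ r c) (hM₁ : ∀ c, IsIso (M.map (homOfLE (h₁ c))))
    (hM₂ : ∀ c, IsIso (M.map (homOfLE (h₂ c)))) : M.IsEncodedBy f :=
  ⟨j.monotone.functor ⋙ M, ⟨(restrictIso M (j.comp f) r h₂ hM₂) ≪≫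
    (restrictIso M OrderHom.id r h₁ hM₁).symm⟩⟩

end PosetModule

/-! ### Extensions of modules over `ℤⁿ` -/

lemma inclusionBar_reflects {n : ℕ} (x y : Fin n → ℤ) (h : inclusionBar n x ≤ inclusionBar n y) :
    x ≤ y := fun i => WithBot.coe_le_coe.1 (h i)

/-- The fibres of the composite of truncation and convex projection are separated by the finite grid
of points with coordinates in `{-∞} ∪ (a i, b i]`. -/
lemma exists_finite_separating {n : ℕ} {a b : Fin n → ℤ} (hab : a ≤ b) :
    ∃ S : Set (Fin n → WithBot ℤ), S.Finite ∧ (∀ c, ∃ s ∈ S, s ≤ c) ∧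
      ∀ c d, c ≤ d → S ∩ Set.Iic c = S ∩ Set.Iic d →
        (convexProjection hab).comp (truncateBelow a) c =
          (convexProjection hab).comp (truncateBelow a) d := by
  let q := (convexProjection hab).comp (truncateBelow a)
  refine ⟨Set.pi Set.univ fun i => insert ⊥ ((↑) '' Set.Ioc (a i) (b i)),
    Set.Finite.pi fun i => ((Set.finite_Ioc _ _).image _).insert _,
    fun c => ⟨⊥, fun i _ => Or.inl rfl, bot_le⟩, fun c d h hS => ?_⟩
  refine le_antisymm (q.monotone h) fun i => ?_
  by_contra hlt
  have hqc : (q c).1 i = max (a i) (min (max (a i) ((c i).unbotD (a i))) (b i)) := rfl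
  have hqd : (q d).1 i = max (a i) (min (max (a i) ((d i).unbotD (a i))) (b i)) := rfl
  change ¬ (q d).1 i ≤ (q c).1 i at hlt
  set z := (q d).1 i with hz
  have hai : a i ≤ b i := hab i
  -- The grid point with `i`-th coordinate `z` and `-∞` elsewhere lies below `d` but not below `c`.
  let s : Fin n → WithBot ℤ := Function.update ⊥ i (z : WithBot ℤ)
  have hsS : s ∈ Set.pi Set.univ fun i => insert (⊥ : WithBot ℤ)
      (((↑) : ℤ → WithBot ℤ) '' Set.Ioc (a i) (b i)) := by
    intro j _
    by_cases hj : j = i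
    · subst hj
      exact Or.inr ⟨z, ⟨by omega, by omega⟩, by simp [s]⟩
    · exact Or.inl (by simp [s, hj])
  have hsle : ∀ e : Fin n → WithBot ℤ, s ≤ e ↔ (z : WithBot ℤ) ≤ e i := fun e => by
    simp only [s, update_le_iff]
    exact and_iff_left fun _ _ => bot_le
  have hsd : s ≤ d := by
    rw [hsle]
    cases hd : d i with
    | bot => rw [hd, WithBot.unbotD_bot] at hqd; omega
    | coe y =>
      rw [hd, WithBot.unbotD_coe] at hqd
      rw [WithBot.coe_le_coe]
      omega
  have hsc : s ≤ c := (hS.symm.subset ⟨hsS, hsd⟩ : s ∈ _ ∩ Set.Iic c).2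
  rw [hsle] at hsc
  cases hc : c i with
  | bot => simp [hc] at hsc
  | coe y =>
    rw [hc, WithBot.unbotD_coe] at hqc
    rw [hc, WithBot.coe_le_coe] at hsc
    omega

namespace PosetModule

lemma isIso_map_of_restrict_iso {R : Type u} [CommRing R] {C D : Type} [PartialOrder C]
    [PartialOrder D] {M : PosetModule R C} {N : PosetModule R D} {f : C →o D}
    (e : f.monotone.functor ⋙ N ≅ M) {S : Set D} (hN : N.IsDetermined S) {c d : C} (h : c ≤ d)
    (hS : S ∩ Set.Iic (f c) = S ∩ Set.Iic (f d)) : IsIso (M.map (homOfLE h)) :=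
  (NatIso.isIso_map_iff e (homOfLE h)).1 (hN.2 _ _ (f.monotone h) hS)

/-- If `N` restricts to `M` and is invertible along inequalities `d ≤ f (r d)`, then every value of
`N` is isomorphic to a value of `M`. -/
lemma pointwiseFinitelyPresented_of_restrict_iso {R : Type u} [CommRing R] {C D : Type}
    [PartialOrder C] [PartialOrder D] {M : PosetModule R C} (hM : M.PointwiseFinitelyPresented)
    {N : PosetModule R D} {f : C →o D} (e : f.monotone.functor ⋙ N ≅ M) {S : Set D}
    (hN : N.IsDetermined S) (r : D → C) (hr : ∀ d, d ≤ f (r d))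
    (hS : ∀ d, S ∩ Set.Iic d = S ∩ Set.Iic (f (r d))) : N.PointwiseFinitelyPresented := fun d => by
  have := hM (r d)
  have := hN.2 _ _ (hr d) (hS d)
  exact Module.FinitePresentation.of_equiv
    ((asIso (N.map (homOfLE (hr d)))) ≪≫ e.app (r d)).toLinearEquiv.symm

variable {R : Type u} [CommRing R] {n : ℕ}

lemma IsFinitelyDetermined.exists_isDetermined {M : PosetModule R (Fin n → ℤ)}
    (hM : M.IsFinitelyDetermined) :
    ∃ S : Set (Fin n → WithBot ℤ), S.Finite ∧ M.extend.IsDetermined S := by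
  obtain ⟨-, a, b, hab, N, ⟨e⟩⟩ := hM
  obtain ⟨S, hfin, hbot, hS⟩ := exists_finite_separating hab
  have hq : ((convexProjection hab).comp (truncateBelow a)).comp (inclusionBar n) =
      convexProjection hab := by
    refine OrderHom.ext _ _ (funext fun c => Subtype.ext (funext fun i => ?_))
    have : a i ≤ b i := hab i
    change max (a i) (min (max (a i) (c i)) (b i)) = max (a i) (min (c i) (b i))
    omega
  rw [← hq] at e
  obtain ⟨e'⟩ := nonempty_coind_iso_restrict M N (inclusionBar n) inclusionBar_reflects
    (truncateBelow a) (le_truncateBelow a) ((convexProjection hab).comp (truncateBelow a))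
    (fun d => congrArg (convexProjection hab) (funext fun i =>
      (max_eq_right (le_max_left (a i) _)).symm)) e
  exact ⟨S, hfin, (isDetermined_restrict N _ hbot hS).of_iso e'⟩

lemma isFinitelyDetermined_of_extend {M : PosetModule R (Fin n → ℤ)}
    (hM : M.PointwiseFinitelyPresented) {S : Set (Fin n → WithBot ℤ)} (hfin : S.Finite)
    (hS : M.extend.IsDetermined S) : M.IsFinitelyDetermined := by
  obtain ⟨a, b, hab, hb⟩ := exists_bounds hfin
  obtain ⟨e⟩ := nonempty_restrict_coind_iso M (inclusionBar n) inclusionBar_reflects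
  refine ⟨hM, a, b, hab, ?_⟩
  refine isEncodedBy_of_isIso M (convexProjection hab) (OrderHom.Subtype.val _)
    ((truncateBelow a).comp (inclusionBar n)) (fun c i => le_max_right _ _)
    (fun c i => max_le_max le_rfl (min_le_left _ _))
    (fun c => isIso_map_of_restrict_iso e hS _
      (inter_Iic_truncateBelow (fun s hs i z hz => (hb s hs i z hz).1) _))
    (fun c => isIso_map_of_restrict_iso e hS _ ?_)
  refine Set.ext fun s => and_congr_right fun hs => ⟨fun h => le_trans h
    ((inclusionBar n).monotone fun i => max_le_max le_rfl (min_le_left _ _)), fun h i => ?_⟩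
  have hi : s i ≤ ((max (a i) (c i) : ℤ) : WithBot ℤ) := h i
  change s i ≤ ((max (a i) (min (c i) (b i)) : ℤ) : WithBot ℤ)
  cases hz : s i with
  | bot => exact bot_le
  | coe z =>
    have h1 := hb s hs i z hz
    rw [hz, WithBot.coe_le_coe] at hi
    rw [WithBot.coe_le_coe]
    omega

lemma isFinitelyPresented_extend {M : PosetModule R (Fin n → ℤ)}
    (hM : M.PointwiseFinitelyPresented) {S : Set (Fin n → WithBot ℤ)} (hfin : S.Finite)
    (hS : M.extend.IsDetermined S) : M.extend.IsFinitelyPresented := by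
  obtain ⟨a, b, -, hb⟩ := exists_bounds hfin
  obtain ⟨G, hG, hSG, hmax⟩ := exists_finite_superset_isGreatest hfin
  obtain ⟨e⟩ := nonempty_restrict_coind_iso M (inclusionBar n) inclusionBar_reflects
  exact hS.isFinitelyPresented (pointwiseFinitelyPresented_of_restrict_iso hM e hS
    (truncateBelow a) (le_truncateBelow a)
    (inter_Iic_truncateBelow fun s hs i z hz => (hb s hs i z hz).1)) hG hSG hmax

end PosetModule

end

theorem mainTheorem2 {R : Type u} [CommRing R] {n : ℕ} (M : PosetModule R (Fin n → ℤ))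
    (hM : M.PointwiseFinitelyPresented) :
    List.TFAE [
      M.IsFinitelyDetermined,
      ∃ S : Set (Fin n → WithBot ℤ), S.Finite ∧ M.extend.IsDetermined S,
      M.extend.IsFinitelyPresented] := by
  tfae_have 1 → 2 := fun h => h.exists_isDetermined
  tfae_have 2 → 1 := fun ⟨_, hfin, hS⟩ => PosetModule.isFinitelyDetermined_of_extend hM hfin hS
  tfae_have 2 → 3 := fun ⟨_, hfin, hS⟩ => PosetModule.isFinitelyPresented_extend hM hfin hS
  tfae_have 3 → 2 := fun h => h.exists_isDetermined
  tfae_finish
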